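/- Let $n \ge 1$ be an integer and let $G = (D \sqcup C, E)$ be a finite simple bipartite graph (a Tanner graph) with parts $D$ (data vertices) and $C$ (check vertices), $|D| = |C| = n$, every edge joining a vertex of $D$ to a vertex of $C$. A bipartite graph is called biplanar if its edge set can be partitioned into the edge sets of two planar bipartite graphs on the same vertex set (an empty edge set is allowed); its bipartite thickness is the least number $k$ such that its edge set can be partitioned into the edge sets of $k$ planar bipartite graphs on the same vertex set. If every check vertex in $C$ has degree at least $8$ in $G$, then $G$ is not biplanar; equivalently, the bipartite thickness of $G$ is at least $3$. -/

import Mathlib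

namespace SimpleGraph

universe u

/-- An embedding of a simple graph in the Euclidean plane: vertices are placed at pairwise distinct
points, each edge is drawn as a simple (continuous, injective) arc joining the points of its two
ends, no arc passes through a vertex in its interior, and two different arcs meet only at points
of common end vertices. -/
structure PlaneEmbedding {V : Type u} (G : SimpleGraph V) where
  /-- the position of each vertex -/
  point : V → EuclideanSpace ℝ (Fin 2)
  /-- the curve that represents each edge -/
  arc : G.edgeSet → C(unitInterval, EuclideanSpace ℝ (Fin 2))
  point_injective : Function.Injective point
  arc_injective : ∀ e, Function.Injective (arc e)
  arc_ends : ∀ e : G.edgeSet, s(arc e 0, arc e 1) = Sym2.map point (e : Sym2 V)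
  arc_avoids : ∀ (e : G.edgeSet) (t : unitInterval) (v : V), arc e t = point v → t = 0 ∨ t = 1
  arc_inter : ∀ e e' : G.edgeSet, e ≠ e' → ∀ s t : unitInterval,
    arc e s = arc e' t → (s = 0 ∨ s = 1) ∧ (t = 0 ∨ t = 1)

/-- A graph is planar if it can be embedded in the plane. -/
def IsPlanar {V : Type u} (G : SimpleGraph V) : Prop :=
  Nonempty G.PlaneEmbedding

/-- The edge set of `G` is partitioned into `k` (possibly empty) layers, each of which is
a planar bipartite graph on the vertex set of `G`. -/
def HasPlanarBipartiteLayers {V : Type u} (G : SimpleGraph V) (k : ℕ) : Prop :=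
  ∃ H : Fin k → SimpleGraph V,
    (∀ i, (H i).IsPlanar ∧ (H i).IsBipartite) ∧
    (∀ i j, i ≠ j → Disjoint (H i).edgeSet (H j).edgeSet) ∧
    (⋃ i, (H i).edgeSet) = G.edgeSet

/-- A graph is biplanar if its edge set can be partitioned into two planar bipartite graphs
on the same vertex set. -/
def IsBiplanar {V : Type u} (G : SimpleGraph V) : Prop :=
  ∃ H₁ H₂ : SimpleGraph V,
    (H₁.IsPlanar ∧ H₁.IsBipartite) ∧ (H₂.IsPlanar ∧ H₂.IsBipartite) ∧
    Disjoint H₁.edgeSet H₂.edgeSet ∧ H₁.edgeSet ∪ H₂.edgeSet = G.edgeSet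

/-- The bipartite thickness: the least number of planar bipartite graphs on the same vertex set
into which the edge set can be partitioned (`⊤` if there is no such finite partition). -/
noncomputable def bipartiteThickness {V : Type u} (G : SimpleGraph V) : ℕ∞ :=
  ⨅ (k : ℕ) (_ : G.HasPlanarBipartiteLayers k), (k : ℕ∞)

end SimpleGraph

/-! Each check has degree at least 8, so `G` has at least 8n edges, while a planar bipartite graph
on 2n vertices has at most 4n - 2 (`ncard_edgeSet_add_two_le`); two layers cannot suffice.

The planar bound avoids faces and the Jordan curve theorem. By Mac Lane's condition
(`IsTwoGenerated`) the mod 2 cycle space is spanned by a family using each edge at most twice.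
Nonzero cycles of a bipartite graph have at least 4 edges and the cycle space has dimension at least
|E| - |V| + 1, so double counting gives 4(|E| - |V| + 1) ≤ 2|E|.

Mac Lane's condition comes from discretization. A drawing, magnified enough, exhibits the graph as a
minor of the square grid (`exists_branchSets`, `exists_magnification`). Finite subgraphs of the grid
satisfy the condition because unit squares generate the cycles (`isTwoGenerated_gridCycles`), and it
passes to minors (`IsTwoGenerated.delete`, `isTwoGenerated_ker_boundary`). -/

namespace PlanarBipartite

open Finset

/-! ### Mac Lane's condition and its dimension bound. -/

section TwoGenerated

variable {E V : Type*}

/-- The mod 2 boundary map of the multigraph with edge set `E` and end maps `s`, `t`. -/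
noncomputable def boundary (s t : E → V) : (E →₀ ZMod 2) →ₗ[ZMod 2] (V →₀ ZMod 2) :=
  Finsupp.linearCombination (ZMod 2) fun e => Finsupp.single (s e) 1 + Finsupp.single (t e) 1

lemma boundary_single (s t : E → V) (e : E) (a : ZMod 2) :
    boundary s t (Finsupp.single e a) = Finsupp.single (s e) a + Finsupp.single (t e) a := by
  simp [boundary, Finsupp.linearCombination_single]

/-- Mac Lane's condition: a finite family spans `Z` and every edge lies in at most two of
its members. -/
def IsTwoGenerated (Z : Submodule (ZMod 2) (E →₀ ZMod 2)) : Prop :=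
  ∃ (ι : Type) (S : Finset ι) (b : ι → E →₀ ZMod 2),
    Submodule.span (ZMod 2) (b '' S) = Z ∧ ∀ e, #{i ∈ S | b i e ≠ 0} ≤ 2

lemma zmod_two_eq_one {a : ZMod 2} (h : a ≠ 0) : a = 1 := by
  revert h; revert a; decide

lemma zmod_two_add_self (a : ZMod 2) : a + a = 0 := CharTwo.add_self_eq_zero a

/-- Deleting an edge preserves Mac Lane's condition. -/
lemma IsTwoGenerated.delete {Z : Submodule (ZMod 2) (E →₀ ZMod 2)} (hZ : IsTwoGenerated Z)
    (e : E) : IsTwoGenerated (Z ⊓ LinearMap.ker (Finsupp.lapply (R := ZMod 2) e)) := by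
  classical
  obtain ⟨ι, S, b, hspan, hb⟩ := hZ
  by_cases h0 : ∃ i₀ ∈ S, b i₀ e ≠ 0
  swap
  · push Not at h0
    refine ⟨ι, S, b, ?_, hb⟩
    rw [hspan, eq_comm, inf_eq_left, ← hspan, Submodule.span_le]
    rintro _ ⟨i, hi, rfl⟩
    simpa using h0 i hi
  obtain ⟨i₀, hi₀, h0⟩ := h0
  have h1 : b i₀ e = 1 := zmod_two_eq_one h0
  -- Merging the two faces at `e`: `π` adds `b i₀` to every member through `e`, kills `b i₀` itself,
  -- and projects `Z` onto its elements avoiding `e`.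
  let π : (E →₀ ZMod 2) →ₗ[ZMod 2] (E →₀ ZMod 2) :=
    LinearMap.id + (Finsupp.lapply (R := ZMod 2) e).smulRight (b i₀)
  have hπ (z) : π z = z + z e • b i₀ := rfl
  refine ⟨ι, S, fun i => π (b i), ?_, fun e' => ?_⟩
  · have : (fun i => π (b i)) '' (S : Set ι) = π '' (b '' S) := by rw [Set.image_image]
    rw [this, ← Submodule.map_span, hspan]
    ext z
    constructor
    · rintro ⟨y, hy, rfl⟩
      have hm : b i₀ ∈ Z := hspan ▸ Submodule.subset_span ⟨i₀, hi₀, rfl⟩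
      refine ⟨Z.add_mem hy (Z.smul_mem _ hm), ?_⟩
      simp [hπ, h1, zmod_two_add_self]
    · rintro ⟨hz, hze⟩
      refine ⟨z, hz, ?_⟩
      have : z e = 0 := hze
      simp [hπ, this]
  -- At most one member other than `b i₀` passes through `e`, so `π` changes only that one.
  · have key : ∀ i ∈ S, i ≠ i₀ → b i e ≠ 0 → ∀ j ∈ S, j ≠ i₀ → j ≠ i → b j e = 0 := by
      intro i hi hii hie j hj hji hji'
      by_contra hje
      have : ({i₀, i, j} : Finset ι) ⊆ {i ∈ S | b i e ≠ 0} := by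
        intro k hk
        simp only [mem_insert, mem_singleton] at hk
        rcases hk with rfl | rfl | rfl <;> simp_all
      have h3 := (card_le_card this).trans (hb e)
      rw [card_insert_of_notMem (by simp [hii.symm, hji.symm]),
        card_insert_of_notMem (by simpa using hji'.symm)] at h3
      simp at h3
    by_cases hsub : {i ∈ S | (π (b i)) e' ≠ 0} ⊆ {i ∈ S | b i e' ≠ 0}
    · exact (card_le_card hsub).trans (hb e')
    obtain ⟨i₁, hi₁, hi₁'⟩ := not_subset.mp hsub
    simp only [mem_filter, hπ, not_and, not_not] at hi₁ hi₁'
    obtain ⟨hS₁, hne⟩ := hi₁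
    have hz₁ := hi₁' hS₁
    have hb0 : b i₀ e' ≠ 0 := by
      rintro h; simp [h, hz₁] at hne
    have he₁ : b i₁ e ≠ 0 := by
      rintro h; simp [h, hz₁] at hne
    have hi₁₀ : i₁ ≠ i₀ := by rintro rfl; exact hb0 hz₁
    -- If `i₁` newly uses `e'`, it inherited `e'` from `b i₀`, which has vanished: the count does
    -- not grow.
    have : {i ∈ S | (π (b i)) e' ≠ 0} ⊆ insert i₁ ({i ∈ S | b i e' ≠ 0}.erase i₀) := by
      intro j hj
      simp only [mem_filter, hπ] at hj
      by_cases hj0 : j = i₀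
      · subst hj0
        exact absurd hj.2 (by simp [h1, zmod_two_add_self])
      by_cases hj1 : j = i₁
      · simp [hj1]
      have := key i₁ hS₁ hi₁₀ he₁ j hj.1 hj0 hj1
      simp only [this, zero_smul, add_zero] at hj
      simp [hj0, hj.1, hj.2]
    refine (card_le_card this).trans ((card_insert_le _ _).trans ?_)
    rw [card_erase_add_one (by simp [hi₀, hb0])]
    exact hb e'

lemma IsTwoGenerated.delete_finset {Z : Submodule (ZMod 2) (E →₀ ZMod 2)}
    (hZ : IsTwoGenerated Z) (S : Finset E) :
    IsTwoGenerated (Z ⊓ ⨅ e ∈ S, LinearMap.ker (Finsupp.lapply (R := ZMod 2) e)) := by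
  classical
  induction S using Finset.induction_on with
  | empty => simpa using hZ
  | insert e S _ ih =>
    rw [Finset.iInf_insert, inf_comm (LinearMap.ker _), ← inf_assoc]
    exact ih.delete e

/-- Mac Lane's condition passes to the pull-back along an injection of edge sets. -/
lemma IsTwoGenerated.comap {E' : Type*} {Z : Submodule (ZMod 2) (E →₀ ZMod 2)}
    (hZ : IsTwoGenerated Z) (ρ : E' → E) (hρ : Function.Injective ρ) :
    IsTwoGenerated (Z.map (Finsupp.lcomapDomain (R := ZMod 2) ρ hρ)) := by
  obtain ⟨ι, S, b, hspan, hb⟩ := hZ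
  refine ⟨ι, S, fun i => Finsupp.lcomapDomain (R := ZMod 2) ρ hρ (b i), ?_, fun e => hb (ρ e)⟩
  rw [← hspan, Submodule.map_span, Set.image_image]

/-- If every nonzero member of `Z` has at least `k` edges, then Mac Lane's condition bounds the
dimension of `Z`. -/
lemma IsTwoGenerated.mul_finrank_le [Fintype E] {Z : Submodule (ZMod 2) (E →₀ ZMod 2)}
    (hZ : IsTwoGenerated Z) (k : ℕ) (hk : ∀ z ∈ Z, z ≠ 0 → k ≤ #z.support) :
    k * Module.finrank (ZMod 2) Z ≤ 2 * Fintype.card E := by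
  classical
  obtain ⟨ι, S, b, hspan, hb⟩ := hZ
  set S' := {i ∈ S | b i ≠ 0} with hS'
  have hle : Z ≤ Submodule.span (ZMod 2) (S'.image b : Set (E →₀ ZMod 2)) := by
    rw [← hspan, Submodule.span_le]
    rintro _ ⟨i, hi, rfl⟩
    by_cases h : b i = 0
    · rw [h]; exact Submodule.zero_mem _
    · exact Submodule.subset_span (by
        simp only [coe_image]; exact ⟨i, by simpa [hS', h] using hi, rfl⟩)
  have h1 : Module.finrank (ZMod 2) Z ≤ #S' :=
    (Submodule.finrank_mono hle).trans ((finrank_span_finset_le_card _).trans card_image_le)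
  have h2 : #S' * k ≤ ∑ i ∈ S', #(b i).support := by
    rw [← smul_eq_mul]
    refine card_nsmul_le_sum _ _ _ fun i hi => ?_
    rw [hS', mem_filter] at hi
    exact hk _ (hspan ▸ Submodule.subset_span ⟨i, hi.1, rfl⟩) hi.2
  have h3 : ∑ i ∈ S', #(b i).support ≤ ∑ e : E, #{i ∈ S | b i e ≠ 0} := by
    have : ∀ i, #(b i).support = #(bipartiteAbove (fun i e => b i e ≠ 0) univ i) := by
      intro i; congr 1; ext e; simp [bipartiteAbove]
    simp_rw [this, sum_card_bipartiteAbove_eq_sum_card_bipartiteBelow]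
    refine sum_le_sum fun e _ => card_le_card fun i hi => ?_
    simp only [bipartiteBelow, hS', mem_filter] at hi ⊢
    exact ⟨hi.1.1, hi.2⟩
  have h4 : ∑ e : E, #{i ∈ S | b i e ≠ 0} ≤ Fintype.card E * 2 := by
    rw [← smul_eq_mul]
    exact sum_le_card_nsmul _ _ _ fun e _ => hb e
  calc k * Module.finrank (ZMod 2) Z ≤ k * #S' := Nat.mul_le_mul_left _ h1
    _ = #S' * k := mul_comm _ _
    _ ≤ Fintype.card E * 2 := h2.trans (h3.trans h4)
    _ = _ := mul_comm _ _

/-- The cycle space has dimension at least `|E| - |V| + 1`. -/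
lemma card_add_one_le_finrank_ker_boundary [Fintype E] [Fintype V] [Nonempty V] (s t : E → V) :
    Fintype.card E + 1 ≤
      Module.finrank (ZMod 2) (LinearMap.ker (boundary s t)) + Fintype.card V := by
  -- Every edge has two ends, so boundaries have coefficient sum 0 and lie in a hyperplane.
  let σ : (V →₀ ZMod 2) →ₗ[ZMod 2] ZMod 2 := Finsupp.linearCombination (ZMod 2) fun _ => 1
  have hσ : LinearMap.range (boundary s t) ≤ LinearMap.ker σ := by
    rw [LinearMap.range_le_ker_iff]
    ext e
    simp [boundary, σ, zmod_two_add_self]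
  have hsurj : LinearMap.range σ = ⊤ := by
    rw [LinearMap.range_eq_top]
    intro a
    exact ⟨Finsupp.single (Classical.arbitrary V) a, by simp [σ]⟩
  have h1 := LinearMap.finrank_range_add_finrank_ker (boundary s t)
  have h2 := LinearMap.finrank_range_add_finrank_ker σ
  have h3 := Submodule.finrank_mono hσ
  rw [hsurj, finrank_top, Module.finrank_self, Module.finrank_finsupp_self] at h2
  rw [Module.finrank_finsupp_self] at h1
  omega

end TwoGenerated

/-! ### The square grid and its unit squares. -/

section Grid

/-- The tail of an edge of the grid `ℕ × ℕ`; `(a, b, false)` is the horizontal edge from `(a, b)`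
to `(a + 1, b)` and `(a, b, true)` the vertical edge from `(a, b)` to `(a, b + 1)`. -/
def gridTail (g : ℕ × ℕ × Bool) : ℕ × ℕ := (g.1, g.2.1)

/-- The head of an edge of the grid. -/
def gridHead (g : ℕ × ℕ × Bool) : ℕ × ℕ :=
  if g.2.2 then (g.1, g.2.1 + 1) else (g.1 + 1, g.2.1)

/-- The boundary of the unit square with lower left corner `p`. -/
noncomputable def gridSquare (p : ℕ × ℕ) : (ℕ × ℕ × Bool) →₀ ZMod 2 :=
  Finsupp.single (p.1, p.2, false) 1 + Finsupp.single (p.1, p.2 + 1, false) 1 +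
    Finsupp.single (p.1, p.2, true) 1 + Finsupp.single (p.1 + 1, p.2, true) 1

/-- The edges with tail in the box `[0, M) × [0, M)`. -/
def gridBox (M : ℕ) : Finset (ℕ × ℕ × Bool) := range M ×ˢ range M ×ˢ univ

/-- The cycles of the grid whose support lies in `T`. -/
noncomputable def gridCycles (T : Set (ℕ × ℕ × Bool)) :
    Submodule (ZMod 2) ((ℕ × ℕ × Bool) →₀ ZMod 2) :=
  LinearMap.ker (boundary gridTail gridHead) ⊓ Finsupp.supported (ZMod 2) (ZMod 2) T

lemma boundary_gridSquare (p : ℕ × ℕ) : boundary gridTail gridHead (gridSquare p) = 0 := by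
  simp only [gridSquare, map_add, boundary_single, gridTail, gridHead, if_true, if_false,
    Bool.false_eq_true]
  generalize Finsupp.single (p.1, p.2) (1 : ZMod 2) = x
  generalize Finsupp.single (p.1, p.2 + 1) (1 : ZMod 2) = y
  generalize Finsupp.single (p.1 + 1, p.2) (1 : ZMod 2) = z
  generalize Finsupp.single (p.1 + 1, p.2 + 1) (1 : ZMod 2) = w
  have h (x : ℕ × ℕ →₀ ZMod 2) : x + x = 0 := by ext; simp [zmod_two_add_self]
  calc _ = (x + x) + (y + y) + (z + z) + (w + w) := by abel
    _ = 0 := by simp [h]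

/-- The case splits remove the nonexistent edges to the left of and below the quadrant, where
truncated subtraction would return a real edge. -/
lemma boundary_grid_apply (z : (ℕ × ℕ × Bool) →₀ ZMod 2) (a b : ℕ) :
    boundary gridTail gridHead z (a, b) = z (a, b, false) + z (a, b, true) +
      (if a = 0 then 0 else z (a - 1, b, false)) + (if b = 0 then 0 else z (a, b - 1, true)) := by
  induction z using Finsupp.induction_linear with
  | zero => simp
  | add f g hf hg =>
    rw [map_add, Finsupp.add_apply, hf, hg]
    split_ifs <;> simp only [Finsupp.add_apply] <;> ring
  | single g c =>
    obtain ⟨i, j, _ | _⟩ := g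
    all_goals
      simp only [boundary_single, gridTail, gridHead, Finsupp.add_apply, Finsupp.single_apply,
        Prod.mk.injEq, if_true, if_false, Bool.false_eq_true, and_false, and_true]
      rcases a with _ | a <;> rcases b with _ | b <;> simp

end Grid

/-! ### Unit squares generate the cycles of the grid. -/

section GridCycles

lemma mem_supported_gridBox_apply {M : ℕ} {z : (ℕ × ℕ × Bool) →₀ ZMod 2}
    (hz : z ∈ Finsupp.supported (ZMod 2) (ZMod 2) (gridBox M : Set (ℕ × ℕ × Bool)))
    {a b : ℕ} {i : Bool} (h : M ≤ a ∨ M ≤ b) : z (a, b, i) = 0 := by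
  by_contra hne
  have := hz (Finsupp.mem_support_iff.mpr hne)
  simp only [gridBox, coe_product, Set.mem_prod, coe_range, Set.mem_Iio] at this
  omega

/-- A cycle in a box is the sum of the squares which it encloses. -/
lemma eq_sum_gridSquare {M : ℕ} {z : (ℕ × ℕ × Bool) →₀ ZMod 2}
    (hz : z ∈ gridCycles (gridBox M)) :
    z = ∑ p ∈ range M ×ˢ range M, (∑ a ∈ range (p.1 + 1), z (a, p.2, true)) • gridSquare p := by
  obtain ⟨hz, hM⟩ := hz
  have hv (a b) := mem_supported_gridBox_apply hM (a := a) (b := b) (i := true)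
  have hh (a b) := mem_supported_gridBox_apply hM (a := a) (b := b) (i := false)
  have hcyc (a b : ℕ) := boundary_grid_apply z a b
  have hz : boundary gridTail gridHead z = 0 := hz
  simp only [hz, Finsupp.coe_zero, Pi.zero_apply] at hcyc
  -- `w a b` is the mod 2 winding number of `z` around the square at `(a, b)`: the parity of the
  -- edges crossed by a ray to the left.
  set w : ℕ → ℕ → ZMod 2 := fun a b => ∑ a' ∈ range (a + 1), z (a', b, true) with hw
  have two (x : ZMod 2) : x + x = 0 := zmod_two_add_self x
  have hw0 (b) : w 0 b = z (0, b, true) := by simp [hw]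
  have hws (a b) : w (a + 1) b = w a b + z (a + 1, b, true) := by
    simp [hw, sum_range_succ _ (a + 1)]
  have hhor0 (a) : w a 0 = z (a, 0, false) := by
    induction a with
    | zero => rw [hw0]; have := hcyc 0 0; simp at this; linear_combination this + two (z (0, 0, true))
    | succ a ih =>
      rw [hws, ih]
      have := hcyc (a + 1) 0
      simp at this
      linear_combination this + two (z (a + 1, 0, true)) + two (z (a, 0, false))
  -- The winding number also jumps by `z` across horizontal edges; moving one column right uses the
  -- cycle equation at the vertex passed.
  have hhor (a b) : w a (b + 1) + w a b = z (a, b + 1, false) := by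
    induction a with
    | zero =>
      rw [hw0, hw0]
      have := hcyc 0 (b + 1)
      simp at this
      linear_combination this + two (z (0, b + 1, true)) + two (z (0, b, true))
    | succ a ih =>
      rw [hws, hws]
      have := hcyc (a + 1) (b + 1)
      simp at this
      linear_combination ih + this + two (z (a + 1, b + 1, true)) + two (z (a + 1, b, true)) +
        two (z (a, b + 1, false))
  have hwb (a b) (h : M ≤ b) : w a b = 0 := sum_eq_zero fun a' _ => hv a' b (Or.inr h)
  -- To the right of the box, climb from the bottom row: no edge of `z` is crossed.
  have hwa (a b) (h : M ≤ a) : w a b = 0 := by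
    induction b with
    | zero => rw [hhor0, hh _ _ (Or.inl h)]
    | succ b ih => simpa [ih, hh _ _ (Or.inl h)] using hhor a b
  have hS (a b : ℕ) : (if a < M ∧ b < M then w a b else 0) = w a b := by
    split_ifs with h
    · rfl
    · rcases not_and_or.mp h with h | h
      · exact (hwa a b (not_lt.mp h)).symm
      · exact (hwb a b (not_lt.mp h)).symm
  have hsum (q : ℕ × ℕ) : ∑ p ∈ range M ×ˢ range M, (if p = q then w p.1 p.2 else 0) = w q.1 q.2 := by
    rw [sum_ite_eq']
    simpa only [mem_product, mem_range] using hS q.1 q.2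
  have hvert (a b) : w (a + 1) b + w a b = z (a + 1, b, true) := by
    rw [hws]; linear_combination two (w a b)
  change z = ∑ p ∈ range M ×ˢ range M, w p.1 p.2 • gridSquare p
  ext ⟨a, b, i⟩
  rw [Finsupp.finsetSum_apply]
  cases i
  · rcases b with _ | b
    · rw [← hhor0, ← hsum (a, 0)]
      refine sum_congr rfl fun p _ => ?_
      simp [gridSquare, Finsupp.single_apply, Prod.ext_iff]
    · rw [← hhor, ← hsum (a, b), ← hsum (a, b + 1), ← sum_add_distrib]
      refine sum_congr rfl fun p _ => ?_
      simp [gridSquare, Finsupp.single_apply, Prod.ext_iff]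
  · rcases a with _ | a
    · rw [← hw0, ← hsum (0, b)]
      refine sum_congr rfl fun p _ => ?_
      simp [gridSquare, Finsupp.single_apply, Prod.ext_iff]
    · rw [← hvert, ← hsum (a, b), ← hsum (a + 1, b), ← sum_add_distrib]
      refine sum_congr rfl fun p _ => ?_
      simp [gridSquare, Finsupp.single_apply, Prod.ext_iff]

lemma card_gridSquare_le_two (S : Finset (ℕ × ℕ)) (g : ℕ × ℕ × Bool) :
    #{p ∈ S | gridSquare p g ≠ 0} ≤ 2 := by
  obtain ⟨a, b, _ | _⟩ := g
  · refine (card_le_card (t := {(a, b), (a, b - 1)}) fun p hp => ?_).trans card_le_two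
    simp only [mem_filter, gridSquare, Finsupp.add_apply, Finsupp.single_apply] at hp
    obtain ⟨i, j⟩ := p
    by_contra h
    simp only [mem_insert, mem_singleton, Prod.mk.injEq] at h
    refine hp.2 ?_
    simp only [Prod.mk.injEq, Bool.true_eq_false, and_false, and_true, if_false, add_zero]
    rw [if_neg (by omega), if_neg (by omega), add_zero]
  · refine (card_le_card (t := {(a, b), (a - 1, b)}) fun p hp => ?_).trans card_le_two
    simp only [mem_filter, gridSquare, Finsupp.add_apply, Finsupp.single_apply] at hp
    obtain ⟨i, j⟩ := p
    by_contra h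
    simp only [mem_insert, mem_singleton, Prod.mk.injEq] at h
    refine hp.2 ?_
    simp only [Prod.mk.injEq, Bool.false_eq_true, and_false, and_true, if_false, zero_add]
    rw [if_neg (by omega), if_neg (by omega), add_zero]

/-- The cycle space of a finite subgraph of the grid satisfies Mac Lane's condition. -/
lemma isTwoGenerated_gridCycles {T : Set (ℕ × ℕ × Bool)} (hT : T.Finite) :
    IsTwoGenerated (gridCycles T) := by
  classical
  obtain ⟨M, hM⟩ : ∃ M, T ⊆ gridBox M := by
    obtain ⟨A, hA⟩ := (hT.image fun g => g.1 + g.2.1).bddAbove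
    refine ⟨A + 1, fun g hg => ?_⟩
    have : g.1 + g.2.1 ≤ A := hA ⟨g, hg, rfl⟩
    simp only [gridBox, coe_product, Set.mem_prod, coe_range, Set.mem_Iio, coe_univ, Set.mem_univ,
      and_true]
    omega
  have hbox : IsTwoGenerated (Submodule.span (ZMod 2)
      (gridSquare '' (range M ×ˢ range M : Finset (ℕ × ℕ)))) :=
    ⟨ℕ × ℕ, _, gridSquare, rfl, card_gridSquare_le_two _⟩
  -- Delete all edges outside `T`. The box is enlarged to `M + 1` because squares with corner in
  -- `gridBox M` have top and right edges with a tail coordinate up to `M`.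
  convert hbox.delete_finset ({g ∈ gridBox (M + 1) | g ∉ T}) using 1
  have hsq {z} (hz : z ∈ Submodule.span (ZMod 2)
      (gridSquare '' (range M ×ˢ range M : Finset (ℕ × ℕ)))) :
      z ∈ gridCycles (gridBox (M + 1)) := by
    refine Submodule.span_le.mpr ?_ hz
    rintro _ ⟨⟨a, b⟩, hp, rfl⟩
    refine ⟨boundary_gridSquare _, ?_⟩
    simp only [coe_product, coe_range, Set.mem_prod, Set.mem_Iio] at hp
    refine Submodule.add_mem _ (Submodule.add_mem _ (Submodule.add_mem _ ?_ ?_) ?_) ?_ <;>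
    · refine Finsupp.single_mem_supported _ _ ?_
      simp only [gridBox, coe_product, Set.mem_prod, coe_range, Set.mem_Iio, coe_univ,
        Set.mem_univ, and_true]
      omega
  ext z
  simp only [Submodule.mem_inf, Submodule.mem_iInf, LinearMap.mem_ker, Finsupp.lapply_apply,
    mem_filter]
  constructor
  · intro hz
    have hz' : z ∈ gridCycles (gridBox M) := ⟨hz.1, Finsupp.supported_mono hM hz.2⟩
    refine ⟨?_, fun g hg => ?_⟩
    · rw [eq_sum_gridSquare hz']
      exact Submodule.sum_mem _ fun p hp =>
        Submodule.smul_mem _ _ (Submodule.subset_span ⟨p, hp, rfl⟩)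
    · by_contra h
      exact hg.2 (hz.2 (Finsupp.mem_support_iff.mpr h))
  · rintro ⟨hz, h0⟩
    refine ⟨(hsq hz).1, fun g hg => ?_⟩
    by_contra hgT
    exact Finsupp.mem_support_iff.mp hg (h0 g ⟨(hsq hz).2 hg, hgT⟩)

end GridCycles

/-! ### Connected sets and branch sets. -/

section Connectivity

variable {X : Type*}

/-- The set `B` is connected for the relation `r`: a part of it that is closed under `r` is empty
or everything. -/
def ConnectedFor (r : X → X → Prop) (B : Set X) : Prop :=
  ∀ P : Set X, (∃ x ∈ B, x ∈ P) → (∀ x ∈ B, x ∈ P → ∀ y ∈ B, r x y → y ∈ P) → B ⊆ P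

/-- By symmetry of `r`, if `P` missed `x` then non-membership would propagate along every path from
`x`. -/
lemma connectedFor_reachable {r : X → X → Prop} (hr : ∀ ⦃x y⦄, r x y → r y x) (S : Set X) (x : X) :
    ConnectedFor r {y | Relation.ReflTransGen (fun a b => r a b ∧ b ∈ S) x y} := by
  rintro P ⟨p, hp, hpP⟩ hcl
  have hx : x ∈ P := by
    by_contra hx
    have : ∀ y, Relation.ReflTransGen (fun a b => r a b ∧ b ∈ S) x y → y ∉ P := by
      intro y hy
      induction hy with
      | refl => exact hx
      | tail h1 h2 ih => exact fun h => ih (hcl _ (h1.tail h2) h _ h1 (hr h2.1))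
    exact this p hp hpP
  intro y hy
  induction hy with
  | refl => exact hx
  | tail h1 h2 ih => exact hcl _ h1 ih _ (h1.tail h2) h2.1

lemma ConnectedFor.union_iUnion {r : X → X → Prop} {ι : Type*} {B : Set X} {R : ι → Set X}
    (hB : ConnectedFor r B) (hR : ∀ i, ConnectedFor r (R i)) (h : ∀ i, ∃ x ∈ B, x ∈ R i) :
    ConnectedFor r (B ∪ ⋃ i, R i) := by
  rintro P ⟨p, hp, hpP⟩ hcl
  have hRi (i) (hi : ∃ x ∈ R i, x ∈ P) : R i ⊆ P := hR i P hi fun x hx hxP y hy =>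
    hcl x (Or.inr (Set.mem_iUnion.mpr ⟨i, hx⟩)) hxP y (Or.inr (Set.mem_iUnion.mpr ⟨i, hy⟩))
  have hBP : B ⊆ P := by
    refine hB P ?_ fun x hx hxP y hy => hcl x (Or.inl hx) hxP y (Or.inl hy)
    rcases hp with hp | hp
    · exact ⟨p, hp, hpP⟩
    · obtain ⟨i, hi⟩ := Set.mem_iUnion.mp hp
      obtain ⟨x, hx, hx'⟩ := h i
      exact ⟨x, hx, hRi i ⟨p, hi, hpP⟩ hx'⟩
  refine Set.union_subset hBP (Set.iUnion_subset fun i => hRi i ?_)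
  obtain ⟨x, hx, hx'⟩ := h i
  exact ⟨x, hx', hBP hx⟩

/-- Connected sets that represent the vertices and the edges of a graph, an edge set meeting just
the sets of its ends, can be turned into branch sets of the graph as a minor. -/
lemma exists_branchSets {V E : Type*} {r : X → X → Prop} (hr : ∀ ⦃x y⦄, r x y → r y x) (src tgt : E → V)
    (hne : ∀ e, src e ≠ tgt e) (B : V → Set X) (A : E → Set X)
    (hB : ∀ v, ConnectedFor r (B v)) (hA : ∀ e, ConnectedFor r (A e))
    (hBB : ∀ v w, v ≠ w → Disjoint (B v) (B w)) (hAA : ∀ e f, e ≠ f → Disjoint (A e) (A f))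
    (hAB : ∀ e w, w ≠ src e → w ≠ tgt e → Disjoint (A e) (B w))
    (hsrc : ∀ e, (A e ∩ B (src e)).Nonempty) (htgt : ∀ e, (A e ∩ B (tgt e)).Nonempty) :
    ∃ B' : V → Set X, (∀ v, B v ⊆ B' v) ∧ (∀ v, B' v ⊆ B v ∪ ⋃ e, A e) ∧
      (∀ v, ConnectedFor r (B' v)) ∧ (∀ v w, v ≠ w → Disjoint (B' v) (B' w)) ∧
      ∀ e, ∃ x ∈ B' (src e), ∃ y ∈ B' (tgt e), r x y := by
  choose x hxA hxB using hsrc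
  -- The part of `A e` reached from the source before entering the target's set; it is absorbed into
  -- the source's branch set.
  let R : E → Set X := fun e =>
    {y | Relation.ReflTransGen (fun a b => r a b ∧ b ∈ A e \ B (tgt e)) (x e) y}
  have hRA (e) : R e ⊆ A e \ B (tgt e) := by
    intro y hy
    rcases Relation.ReflTransGen.cases_tail hy with h | ⟨_, _, h⟩
    · rw [h]
      exact ⟨hxA e, fun h => Set.disjoint_left.mp (hBB _ _ (hne e)) (hxB e) h⟩
    · exact h.2
  let B' : V → Set X := fun v => B v ∪ ⋃ e : {e // src e = v}, R e
  have hRB (e v) (hv : v ≠ src e) : Disjoint (R e) (B v) := by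
    by_cases h : v = tgt e
    · subst h
      exact Set.disjoint_left.mpr fun y hy => (hRA e hy).2
    · exact (hAB e v hv h).mono_left fun y hy => (hRA e hy).1
  refine ⟨B', fun v => Set.subset_union_left, fun v => ?_, fun v => ?_, fun v w hvw => ?_,
    fun e => ?_⟩
  · exact Set.union_subset_union_right _ (Set.iUnion_subset fun e =>
      fun y hy => Set.mem_iUnion.mpr ⟨e, (hRA _ hy).1⟩)
  · refine (hB v).union_iUnion (fun e => connectedFor_reachable hr _ _) ?_
    rintro ⟨e, rfl⟩
    exact ⟨x e, hxB e, Relation.ReflTransGen.refl⟩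
  · simp only [B', Set.disjoint_union_left, Set.disjoint_union_right, Set.disjoint_iUnion_left,
      Set.disjoint_iUnion_right]
    refine ⟨⟨hBB v w hvw, ?_⟩, fun e => ⟨?_, ?_⟩⟩
    · rintro ⟨e, rfl⟩; exact hRB e _ hvw.symm
    · obtain ⟨e, rfl⟩ := e; exact (hRB e _ hvw).symm
    · obtain ⟨e, rfl⟩ := e
      rintro ⟨f, rfl⟩
      exact (hAA f e (by rintro rfl; exact hvw rfl)).mono (fun y hy => (hRA _ hy).1)
        fun y hy => (hRA _ hy).1
  · by_contra! hcon
    obtain ⟨y, hyA, hyB⟩ := htgt e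
    -- Without a step from `R e` into `B (tgt e)`, `R e` would be closed in `A e`, hence all of it,
    -- although `A e` meets `B (tgt e)`.
    have : A e ⊆ R e := by
      refine hA e (R e) ⟨x e, hxA e, Relation.ReflTransGen.refl⟩ fun a _ ha b hb hab => ?_
      refine Relation.ReflTransGen.tail ha ⟨hab, hb, fun hbB => ?_⟩
      exact hcon a (Or.inr (Set.mem_iUnion.mpr ⟨⟨e, rfl⟩, ha⟩)) b (Or.inl hbB) hab
    exact (hRA e (this hyA)).2 hyB

/-- Adjacency of points of the grid. -/
def GridAdj (x y : ℕ × ℕ) : Prop :=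
  ∃ g, gridTail g = x ∧ gridHead g = y ∨ gridTail g = y ∧ gridHead g = x

lemma GridAdj.symm ⦃x y : ℕ × ℕ⦄ : GridAdj x y → GridAdj y x := fun ⟨g, hg⟩ => ⟨g, hg.symm⟩

/-- Two points of a connected set of the grid bound a chain in that set. -/
lemma ConnectedFor.exists_chain {B : Set (ℕ × ℕ)} (hB : ConnectedFor GridAdj B) {x y : ℕ × ℕ}
    (hx : x ∈ B) (hy : y ∈ B) :
    ∃ c ∈ Finsupp.supported (ZMod 2) (ZMod 2) {g | gridTail g ∈ B ∧ gridHead g ∈ B},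
      boundary gridTail gridHead c = Finsupp.single x 1 + Finsupp.single y 1 := by
  have two (x : ℕ × ℕ →₀ ZMod 2) : x + x = 0 := by ext; simp [zmod_two_add_self]
  have add3 (x y z : ℕ × ℕ →₀ ZMod 2) : (x + y) + (y + z) = x + z := by
    rw [add_assoc, ← add_assoc y, two, zero_add]
  refine hB {y | ∃ c ∈ Finsupp.supported (ZMod 2) (ZMod 2) {g | gridTail g ∈ B ∧ gridHead g ∈ B},
      boundary gridTail gridHead c = Finsupp.single x 1 + Finsupp.single y 1}
    ⟨x, hx, 0, Submodule.zero_mem _, by rw [two, map_zero]⟩ ?_ hy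
  rintro a ha ⟨c, hc, hca⟩ b hb ⟨g, hg⟩
  have hgB : gridTail g ∈ B ∧ gridHead g ∈ B := by
    rcases hg with ⟨rfl, rfl⟩ | ⟨rfl, rfl⟩ <;> exact ⟨by assumption, by assumption⟩
  refine ⟨c + Finsupp.single g 1, Submodule.add_mem _ hc (Finsupp.single_mem_supported _ _ hgB), ?_⟩
  rw [map_add, hca, boundary_single]
  rcases hg with ⟨rfl, rfl⟩ | ⟨rfl, rfl⟩
  · exact add3 _ _ _
  · rw [add_comm (Finsupp.single (gridTail g) (1 : ZMod 2))]
    exact add3 _ _ _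

end Connectivity

/-! ### Mac Lane's condition for minors of the grid. -/

section Minor

variable {V E : Type*}

/-- If a graph with edge set `E` is a minor of the grid, with finite disjoint connected branch sets
`B v` and edges represented by `ρ`, then its cycle space satisfies Mac Lane's condition. -/
lemma isTwoGenerated_ker_boundary [Finite V] [Finite E] (src tgt : E → V)
    (hne : ∀ e, src e ≠ tgt e) (hinj : ∀ e f, src e = src f → tgt e = tgt f → e = f)
    (B : V → Set (ℕ × ℕ)) (hfin : ∀ v, (B v).Finite) (hBne : ∀ v, (B v).Nonempty)
    (hconn : ∀ v, ConnectedFor GridAdj (B v)) (hdisj : ∀ v w, v ≠ w → Disjoint (B v) (B w))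
    (ρ : E → ℕ × ℕ × Bool) (hs : ∀ e, gridTail (ρ e) ∈ B (src e))
    (ht : ∀ e, gridHead (ρ e) ∈ B (tgt e)) :
    IsTwoGenerated (LinearMap.ker (boundary src tgt)) := by
  classical
  have huniq {x v w} (hv : x ∈ B v) (hw : x ∈ B w) : v = w := by
    by_contra h
    exact Set.disjoint_left.mp (hdisj v w h) hv hw
  have hρ : Function.Injective ρ := fun e f h =>
    hinj e f (huniq (hs e) (h ▸ hs f)) (huniq (ht e) (h ▸ ht f))
  let I : V → Set (ℕ × ℕ × Bool) := fun v => {g | gridTail g ∈ B v ∧ gridHead g ∈ B v}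
  have hI {e v} : ρ e ∉ I v := fun h => hne e ((huniq (hs e) h.1).trans (huniq h.2 (ht e)))
  let T : Set (ℕ × ℕ × Bool) := (⋃ v, I v) ∪ Set.range ρ
  have hT : T.Finite := by
    refine (Set.finite_iUnion fun v => ?_).union (Set.finite_range ρ)
    refine (((hfin v).prod (Set.finite_univ (α := Bool))).image
      fun q => (q.1.1, q.1.2, q.2)).subset ?_
    rintro ⟨a, b, i⟩ hg
    exact ⟨((a, b), i), ⟨hg.1, trivial⟩, rfl⟩
  convert (isTwoGenerated_gridCycles hT).comap ρ hρ using 1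
  apply le_antisymm
  · intro z hz
    choose p hp using hBne
    choose cs hcs hcs' using fun e => (hconn (src e)).exists_chain (hs e) (hp (src e))
    choose ct hct hct' using fun e => (hconn (tgt e)).exists_chain (ht e) (hp (tgt e))
    have hsupp {e v} {c : (ℕ × ℕ × Bool) →₀ ZMod 2}
        (hc : c ∈ Finsupp.supported (ZMod 2) (ZMod 2) (I v)) : c (ρ e) = 0 := by
      by_contra h
      exact hI (hc (Finsupp.mem_support_iff.mpr h))
    -- Each edge is prolonged inside the branch sets to the base points `p`, so cycles lift to
    -- cycles; the added chains avoid the edges `ρ f`.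
    let lift : (E →₀ ZMod 2) →ₗ[ZMod 2] ((ℕ × ℕ × Bool) →₀ ZMod 2) :=
      Finsupp.linearCombination (ZMod 2) fun e => Finsupp.single (ρ e) 1 + cs e + ct e
    have h1 : boundary gridTail gridHead ∘ₗ lift =
        Finsupp.lmapDomain (ZMod 2) (ZMod 2) p ∘ₗ boundary src tgt := by
      refine Finsupp.lhom_ext' fun e => LinearMap.ext_ring ?_
      have two (x : ℕ × ℕ →₀ ZMod 2) : x + x = 0 := by ext; simp [zmod_two_add_self]
      simp only [lift, LinearMap.comp_apply, Finsupp.lsingle_apply, Finsupp.linearCombination_single,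
        one_smul, map_add, boundary_single, hcs', hct', Finsupp.lmapDomain_apply,
        Finsupp.mapDomain_single]
      generalize Finsupp.single (gridTail (ρ e)) (1 : ZMod 2) = x
      generalize Finsupp.single (gridHead (ρ e)) (1 : ZMod 2) = y
      generalize Finsupp.single (p (src e)) (1 : ZMod 2) = x'
      generalize Finsupp.single (p (tgt e)) (1 : ZMod 2) = y'
      calc _ = (x + x) + (y + y) + (x' + y') := by abel
        _ = _ := by rw [two, two, zero_add, zero_add]
    have h2 : Finsupp.lcomapDomain (R := ZMod 2) ρ hρ ∘ₗ lift = LinearMap.id := by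
      refine Finsupp.lhom_ext' fun e => LinearMap.ext_ring ?_
      ext f
      simp only [lift, LinearMap.comp_apply, Finsupp.lsingle_apply, Finsupp.linearCombination_single,
        one_smul, LinearMap.id_apply]
      change (Finsupp.single (ρ e) (1 : ZMod 2) + cs e + ct e) (ρ f) = _
      simp only [Finsupp.add_apply, hsupp (hcs e), hsupp (hct e), add_zero, Finsupp.single_apply,
        hρ.eq_iff]
    refine ⟨lift z, ⟨?_, ?_⟩, LinearMap.congr_fun h2 z⟩
    · have := LinearMap.congr_fun h1 z
      simp only [LinearMap.comp_apply, LinearMap.mem_ker.mp hz, map_zero] at this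
      exact this
    · have hmono {v} {c : (ℕ × ℕ × Bool) →₀ ZMod 2}
          (hc : c ∈ Finsupp.supported (ZMod 2) (ZMod 2) (I v)) :
          c ∈ Finsupp.supported (ZMod 2) (ZMod 2) T :=
        Finsupp.supported_mono (fun g hg => Or.inl (Set.mem_iUnion.mpr ⟨v, hg⟩)) hc
      refine Submodule.sum_mem _ fun e _ => Submodule.smul_mem _ _ ?_
      exact Submodule.add_mem _ (Submodule.add_mem _
        (Finsupp.single_mem_supported _ _ (Or.inr ⟨e, rfl⟩)) (hmono (hcs e))) (hmono (hct e))
  · rintro _ ⟨z, ⟨hz, hzT⟩, rfl⟩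
    -- Contraction of branch sets. The default 0 is harmless: edges of `T` have both ends in branch
    -- sets.
    let β : ℕ × ℕ → V →₀ ZMod 2 := fun x =>
      if h : ∃ v, x ∈ B v then Finsupp.single h.choose 1 else 0
    have hβ {x v} (h : x ∈ B v) : β x = Finsupp.single v 1 := by
      have h' : ∃ v, x ∈ B v := ⟨v, h⟩
      simp only [β, dif_pos h', huniq h'.choose_spec h]
    let φ := Finsupp.linearCombination (ZMod 2) β
    have key : ∀ z ∈ Finsupp.supported (ZMod 2) (ZMod 2) T,
        φ (boundary gridTail gridHead z) =
          boundary src tgt (Finsupp.lcomapDomain (R := ZMod 2) ρ hρ z) := by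
      intro z hz
      rw [Finsupp.supported_eq_span_single] at hz
      induction hz using Submodule.span_induction with
      | zero => simp only [map_zero]
      | add x y _ _ hx hy => simp only [map_add, hx, hy]
      | smul a x _ hx => simp only [map_smul, hx]
      | mem x hx =>
        obtain ⟨g, hg, rfl⟩ := hx
        simp only [boundary_single, map_add]
        simp only [φ, Finsupp.linearCombination_single, one_smul]
        rcases hg with hg | ⟨e, rfl⟩
        · obtain ⟨v, hv⟩ := Set.mem_iUnion.mp hg
          have : Finsupp.lcomapDomain (R := ZMod 2) ρ hρ (Finsupp.single g (1 : ZMod 2)) = 0 := by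
            ext e
            change Finsupp.single g (1 : ZMod 2) (ρ e) = 0
            rw [Finsupp.single_apply, if_neg]
            rintro rfl
            exact hI hv
          rw [this, map_zero, hβ hv.1, hβ hv.2]
          ext
          simp [zmod_two_add_self]
        · have : Finsupp.lcomapDomain (R := ZMod 2) ρ hρ (Finsupp.single (ρ e) (1 : ZMod 2)) =
              Finsupp.single e 1 := by
            ext f
            change Finsupp.single (ρ e) (1 : ZMod 2) (ρ f) = _
            simp only [Finsupp.single_apply, hρ.eq_iff]
          rw [this, boundary_single, hβ (hs e), hβ (ht e)]
    rw [LinearMap.mem_ker, ← key z hzT]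
    have hz : boundary gridTail gridHead z = 0 := hz
    rw [hz, map_zero]

end Minor

/-! ### Covering compact sets of the plane by cells. -/

section Cells

/-- The closed unit square with lower left corner `p`. -/
def cell (p : ℕ × ℕ) : Set (ℝ × ℝ) :=
  Set.Icc (p.1 : ℝ) (p.1 + 1) ×ˢ Set.Icc (p.2 : ℝ) (p.2 + 1)

/-- The corners `p` of the closed unit squares that meet `K`. -/
def cells (K : Set (ℝ × ℝ)) : Set (ℕ × ℕ) := {p | (K ∩ cell p).Nonempty}

lemma mem_cell_floor {x : ℝ × ℝ} (h : 0 ≤ x.1 ∧ 0 ≤ x.2) : x ∈ cell (⌊x.1⌋₊, ⌊x.2⌋₊) :=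
  ⟨⟨Nat.floor_le h.1, (Nat.lt_floor_add_one _).le⟩,
    ⟨Nat.floor_le h.2, (Nat.lt_floor_add_one _).le⟩⟩

lemma isClosed_cell (p : ℕ × ℕ) : IsClosed (cell p) := isClosed_Icc.prod isClosed_Icc

lemma finite_cells {K : Set (ℝ × ℝ)} (hK : IsCompact K) : (cells K).Finite := by
  obtain ⟨R, hR⟩ := hK.isBounded.exists_norm_le
  refine ((Set.finite_Iic ⌊R⌋₊).prod (Set.finite_Iic ⌊R⌋₊)).subset ?_
  rintro p ⟨x, hxK, hx⟩
  have h := norm_prod_le_iff.mp (hR x hxK)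
  exact ⟨Nat.le_floor (hx.1.1.trans ((le_abs_self _).trans h.1)),
    Nat.le_floor (hx.2.1.trans ((le_abs_self _).trans h.2))⟩

lemma eq_or_gridAdj_horizontal {a a' : ℕ} (b : ℕ) {x : ℝ} (h : x ∈ Set.Icc (a : ℝ) (a + 1))
    (h' : x ∈ Set.Icc (a' : ℝ) (a' + 1)) : (a, b) = (a', b) ∨ GridAdj (a, b) (a', b) := by
  have h1 : a ≤ a' + 1 := by exact_mod_cast h.1.trans h'.2
  have h2 : a' ≤ a + 1 := by exact_mod_cast h'.1.trans h.2
  obtain rfl | rfl | rfl : a = a' ∨ a = a' + 1 ∨ a' = a + 1 := by omega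
  · exact Or.inl rfl
  · exact Or.inr ⟨(a', b, false), Or.inr ⟨rfl, rfl⟩⟩
  · exact Or.inr ⟨(a, b, false), Or.inl ⟨rfl, rfl⟩⟩

lemma eq_or_gridAdj_vertical (a : ℕ) {b b' : ℕ} {x : ℝ} (h : x ∈ Set.Icc (b : ℝ) (b + 1))
    (h' : x ∈ Set.Icc (b' : ℝ) (b' + 1)) : (a, b) = (a, b') ∨ GridAdj (a, b) (a, b') := by
  have h1 : b ≤ b' + 1 := by exact_mod_cast h.1.trans h'.2
  have h2 : b' ≤ b + 1 := by exact_mod_cast h'.1.trans h.2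
  obtain rfl | rfl | rfl : b = b' ∨ b = b' + 1 ∨ b' = b + 1 := by omega
  · exact Or.inl rfl
  · exact Or.inr ⟨(a, b', true), Or.inr ⟨rfl, rfl⟩⟩
  · exact Or.inr ⟨(a, b, true), Or.inl ⟨rfl, rfl⟩⟩

/-- The cells that meet a connected compact set form a connected set of the grid. -/
lemma connectedFor_cells {K : Set (ℝ × ℝ)} (hK : IsCompact K) (hc : IsPreconnected K)
    (h0 : ∀ x ∈ K, 0 ≤ x.1 ∧ 0 ≤ x.2) : ConnectedFor GridAdj (cells K) := by
  rintro P ⟨p, ⟨x, hxK, hxp⟩, hpP⟩ hcl q ⟨y, hyK, hyq⟩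
  by_contra hqP
  have hfin (Q : Set (ℕ × ℕ)) : IsClosed (⋃ r ∈ cells K ∩ Q, cell r) :=
    ((finite_cells hK).inter_of_left Q).isClosed_biUnion fun r _ => isClosed_cell r
  have hcov : K ⊆ (⋃ r ∈ cells K ∩ P, cell r) ∪ ⋃ r ∈ cells K ∩ Pᶜ, cell r := by
    intro z hz
    have hz' := mem_cell_floor (h0 z hz)
    by_cases h : (⌊z.1⌋₊, ⌊z.2⌋₊) ∈ P
    · exact Or.inl (Set.mem_biUnion ⟨⟨z, hz, hz'⟩, h⟩ hz')
    · exact Or.inr (Set.mem_biUnion ⟨⟨z, hz, hz'⟩, h⟩ hz')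
  -- Cells in `P` and cells outside `P` give two closed sets covering `K`; connectedness makes them
  -- meet.
  obtain ⟨z, hzK, hz1, hz2⟩ := isPreconnected_closed_iff.mp hc _ _ (hfin P) (hfin Pᶜ) hcov
    ⟨x, hxK, Set.mem_biUnion ⟨⟨x, hxK, hxp⟩, hpP⟩ hxp⟩
    ⟨y, hyK, Set.mem_biUnion ⟨⟨y, hyK, hyq⟩, hqP⟩ hyq⟩
  simp only [Set.mem_iUnion, exists_prop] at hz1 hz2
  obtain ⟨⟨a, b⟩, ⟨hr, hrP⟩, hzr⟩ := hz1
  obtain ⟨⟨a', b'⟩, ⟨hs, hsP⟩, hzs⟩ := hz2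
  -- Two cells may share only a corner and so not be adjacent; the intermediate cell `(a', b)` also
  -- contains `z`.
  have hm : (a', b) ∈ cells K := ⟨z, hzK, hzs.1, hzr.2⟩
  have hmP : (a', b) ∈ P := by
    rcases eq_or_gridAdj_horizontal b hzr.1 hzs.1 with h | h
    · exact h ▸ hrP
    · exact hcl _ hr hrP _ hm h
  rcases eq_or_gridAdj_vertical a' hzr.2 hzs.2 with h | h
  · exact hsP (h ▸ hmP)
  · exact hsP (hcl _ hm hmP _ hs h)

/-- Finitely many compact sets of the plane can be moved into the first quadrant and magnified so
that no cell meets two disjoint ones. -/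
lemma exists_magnification {I : Type*} [Finite I] (K : I → Set (ℝ × ℝ))
    (hK : ∀ i, IsCompact (K i)) :
    ∃ f : ℝ × ℝ → ℝ × ℝ, Continuous f ∧ (∀ i, ∀ x ∈ f '' K i, 0 ≤ x.1 ∧ 0 ≤ x.2) ∧
      ∀ i j, Disjoint (K i) (K j) → Disjoint (cells (f '' K i)) (cells (f '' K j)) := by
  obtain ⟨R, hR⟩ := (isCompact_iUnion hK).isBounded.exists_norm_le
  -- Disjoint compact sets have positive distance; scaling makes it exceed 1, the diameter of a cell
  -- in the sup metric of `ℝ × ℝ`.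
  have hN : ∀ᶠ N : ℕ in Filter.atTop, ∀ i j, Disjoint (K i) (K j) →
      ∀ x ∈ K i, ∀ y ∈ K j, 1 < N * dist x y := by
    refine Filter.eventually_all.mpr fun i => Filter.eventually_all.mpr fun j => ?_
    by_cases hd : Disjoint (K i) (K j)
    swap
    · exact Filter.Eventually.of_forall fun N h => absurd h hd
    obtain ⟨δ, hδ, hdist⟩ := Metric.exists_pos_forall_lt_edist (hK i) (hK j).isClosed hd
    filter_upwards [Filter.eventually_gt_atTop ⌈(δ : ℝ)⁻¹⌉₊] with N hN _ x hx y hy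
    have hδ' : (0 : ℝ) < δ := hδ
    have h1 : (δ : ℝ) < dist x y := by
      have := hdist x hx y hy
      rw [edist_nndist] at this
      exact_mod_cast this
    have h2 : (δ : ℝ)⁻¹ < N := (Nat.le_ceil _).trans_lt (by exact_mod_cast hN)
    calc (1 : ℝ) = (δ : ℝ)⁻¹ * δ := (inv_mul_cancel₀ hδ'.ne').symm
      _ < N * dist x y := mul_lt_mul'' h2 h1 (inv_nonneg.mpr hδ'.le) hδ'.le
  obtain ⟨N, hN⟩ := hN.exists
  refine ⟨fun x => (N * (x.1 + R), N * (x.2 + R)), by fun_prop, ?_, fun i j hd => ?_⟩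
  · rintro i _ ⟨x, hx, rfl⟩
    have h := norm_prod_le_iff.mp (hR x (Set.mem_iUnion.mpr ⟨i, hx⟩))
    have h1 := neg_le_of_abs_le h.1
    have h2 := neg_le_of_abs_le h.2
    constructor
    · exact mul_nonneg N.cast_nonneg (by linarith)
    · exact mul_nonneg N.cast_nonneg (by linarith)
  · refine Set.disjoint_left.mpr ?_
    rintro p ⟨_, ⟨x, hx, rfl⟩, hxp⟩ ⟨_, ⟨y, hy, rfl⟩, hyp⟩
    have hlt := hN i j hd x hx y hy
    have hab {u v c : ℝ} (hu : N * (u + R) ∈ Set.Icc c (c + 1))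
        (hv : N * (v + R) ∈ Set.Icc c (c + 1)) : N * dist u v ≤ 1 := by
      rw [Real.dist_eq, ← abs_of_nonneg (N.cast_nonneg (α := ℝ)), ← abs_mul, abs_le]
      constructor <;> nlinarith [hu.1, hu.2, hv.1, hv.2]
    have h1 := hab hxp.1 hyp.1
    have h2 := hab hxp.2 hyp.2
    rw [Prod.dist_eq, mul_max_of_nonneg _ _ N.cast_nonneg] at hlt
    exact absurd hlt (not_lt.mpr (max_le h1 h2))

end Cells

/-! ### From a plane drawing to a grid minor. -/

section Drawing

variable {V : Type*} {H : SimpleGraph V}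

/-- The cycle space of a finite plane graph satisfies Mac Lane's condition. -/
lemma exists_isTwoGenerated_of_planeEmbedding [Finite V] (P : H.PlaneEmbedding) :
    ∃ src tgt : H.edgeSet → V, (∀ e, s(src e, tgt e) = (e : Sym2 V)) ∧
      IsTwoGenerated (LinearMap.ker (boundary src tgt)) := by
  classical
  have hends (e : H.edgeSet) : ∃ u v, s(u, v) = (e : Sym2 V) ∧
      P.arc e 0 = P.point u ∧ P.arc e 1 = P.point v := by
    obtain ⟨⟨a, b⟩, he⟩ := e
    have h := P.arc_ends ⟨s(a, b), he⟩
    rw [Sym2.map_mk] at h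
    rcases Sym2.eq_iff.mp h with ⟨h0, h1⟩ | ⟨h0, h1⟩
    · exact ⟨a, b, rfl, h0, h1⟩
    · exact ⟨b, a, Sym2.eq_swap, h0, h1⟩
  choose src tgt hst h0 h1 using hends
  have hne (e) : src e ≠ tgt e := by
    intro h
    have := e.2
    rw [← hst e, h, SimpleGraph.mem_edgeSet] at this
    exact this.ne rfl
  -- Arcs are cut into thirds: the outer thirds join the stars of the ends, the middle third
  -- represents the edge. Middle thirds are then pairwise disjoint and miss all other stars.
  let a : unitInterval := ⟨1 / 3, by norm_num, by norm_num⟩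
  let b : unitInterval := ⟨2 / 3, by norm_num, by norm_num⟩
  have hab : a < b := Subtype.mk_lt_mk.mpr (by norm_num)
  have ha0 : 0 < a := Subtype.mk_lt_mk.mpr (by norm_num)
  have hb1 : b < 1 := Subtype.mk_lt_mk.mpr (by norm_num)
  let φ : EuclideanSpace ℝ (Fin 2) → ℝ × ℝ := fun x => (x 0, x 1)
  have hφ : Continuous φ := by fun_prop
  have hφi : Function.Injective φ := by
    intro x y h
    ext i
    fin_cases i
    · exact congrArg Prod.fst h
    · exact congrArg Prod.snd h
  -- the parts of the drawing that represent the vertices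
  let star : V → Set (EuclideanSpace ℝ (Fin 2)) := fun v =>
    {P.point v} ∪ ((⋃ e : {e // src e = v}, P.arc e '' Set.Iic a) ∪
      ⋃ e : {e // tgt e = v}, P.arc e '' Set.Ici b)
  have mem_star {v x} (hx : x ∈ star v) : x = P.point v ∨
      ∃ e t, P.arc e t = x ∧ (src e = v ∧ t ≤ a ∨ tgt e = v ∧ b ≤ t) := by
    rcases hx with hx | hx | hx
    · exact Or.inl hx
    · obtain ⟨⟨e, he⟩, t, ht, rfl⟩ := Set.mem_iUnion.mp hx
      exact Or.inr ⟨e, t, rfl, Or.inl ⟨he, ht⟩⟩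
    · obtain ⟨⟨e, he⟩, t, ht, rfl⟩ := Set.mem_iUnion.mp hx
      exact Or.inr ⟨e, t, rfl, Or.inr ⟨he, ht⟩⟩
  have src_star (e t) (ht : t ≤ a) : P.arc e t ∈ star (src e) :=
    Or.inr (Or.inl (Set.mem_iUnion.mpr ⟨⟨e, rfl⟩, t, ht, rfl⟩))
  have tgt_star (e t) (ht : b ≤ t) : P.arc e t ∈ star (tgt e) :=
    Or.inr (Or.inr (Set.mem_iUnion.mpr ⟨⟨e, rfl⟩, t, ht, rfl⟩))
  -- a point of the star of `v` on an arc whose parameter is an end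
  have at_end {v e t} (ht : t = 0 ∨ t = 1)
      (h : src e = v ∧ t ≤ a ∨ tgt e = v ∧ b ≤ t) : P.arc e t = P.point v := by
    rcases ht with rfl | rfl <;> rcases h with ⟨rfl, h⟩ | ⟨rfl, h⟩
    · exact h0 e
    · exact absurd (ha0.trans hab) (not_lt.mpr h)
    · exact absurd (hab.trans hb1) (not_lt.mpr h)
    · exact h1 e
  have star_disj (v w) (hvw : v ≠ w) : Disjoint (star v) (star w) := by
    refine Set.disjoint_left.mpr fun x hv hw => hvw ?_
    rcases mem_star hv with rfl | ⟨e, t, rfl, ht⟩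
    · rcases mem_star hw with hw | ⟨f, s, hs, hs'⟩
      · exact P.point_injective hw
      · exact P.point_injective (hs ▸ at_end (P.arc_avoids f s v hs) hs')
    · rcases mem_star hw with hw | ⟨f, s, hs, hs'⟩
      · exact P.point_injective ((at_end (P.arc_avoids e t w hw) ht).symm.trans hw)
      · by_cases hef : e = f
        · subst hef
          obtain rfl := P.arc_injective e hs
          rcases ht with ⟨rfl, ht⟩ | ⟨rfl, ht⟩ <;> rcases hs' with ⟨rfl, hs'⟩ | ⟨rfl, hs'⟩
          · rfl
          · exact absurd (hs'.trans ht) (not_le.mpr hab)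
          · exact absurd (ht.trans hs') (not_le.mpr hab)
          · rfl
        · obtain ⟨ht0, hs0⟩ := P.arc_inter e f hef t s hs.symm
          exact P.point_injective ((at_end ht0 ht).symm.trans (hs.symm.trans (at_end hs0 hs')))
  have not_end {t : unitInterval} (ht : t ∈ Set.Icc a b) : ¬ (t = 0 ∨ t = 1) := by
    rintro (rfl | rfl)
    · exact absurd ha0 (not_lt.mpr ht.1)
    · exact absurd hb1 (not_lt.mpr ht.2)
  have mid_disj (e f) (hef : e ≠ f) : Disjoint (P.arc e '' Set.Icc a b) (P.arc f '' Set.Icc a b) := by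
    refine Set.disjoint_left.mpr ?_
    rintro _ ⟨t, ht, rfl⟩ ⟨s, hs, hst⟩
    exact not_end ht (P.arc_inter e f hef t s hst.symm).1
  have mid_star (e w) (hs : w ≠ src e) (ht : w ≠ tgt e) :
      Disjoint (P.arc e '' Set.Icc a b) (star w) := by
    refine Set.disjoint_left.mpr ?_
    rintro _ ⟨t, ht', rfl⟩ hw
    rcases mem_star hw with hw | ⟨f, s, hfs, hs'⟩
    · exact not_end ht' (P.arc_avoids e t w hw)
    · by_cases hef : e = f
      · subst hef
        rcases hs' with ⟨rfl, _⟩ | ⟨rfl, _⟩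
        · exact hs rfl
        · exact ht rfl
      · exact not_end ht' (P.arc_inter e f hef t s hfs.symm).1
  have star_compact (v) : IsCompact (star v) :=
    isCompact_singleton.union ((isCompact_iUnion fun e : {e // src e = v} =>
      isClosed_Iic.isCompact.image (P.arc e).continuous).union
      (isCompact_iUnion fun e : {e // tgt e = v} => isClosed_Ici.isCompact.image
      (P.arc e).continuous))
  have star_conn (v) : IsPreconnected (star v) := by
    refine isPreconnected_of_forall (P.point v) fun y hy => ?_
    rcases hy with rfl | hy | hy
    · exact ⟨{P.point v}, Set.subset_union_left, rfl, rfl, isPreconnected_singleton⟩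
    · obtain ⟨⟨e, rfl⟩, hy⟩ := Set.mem_iUnion.mp hy
      refine ⟨P.arc e '' Set.Iic a, ?_, ⟨0, ha0.le, h0 e⟩, hy,
        isPreconnected_Iic.image _ (P.arc e).continuous.continuousOn⟩
      rintro _ ⟨t, ht, rfl⟩
      exact src_star e t ht
    · obtain ⟨⟨e, rfl⟩, hy⟩ := Set.mem_iUnion.mp hy
      refine ⟨P.arc e '' Set.Ici b, ?_, ⟨1, hb1.le, h1 e⟩, hy,
        isPreconnected_Ici.image _ (P.arc e).continuous.continuousOn⟩
      rintro _ ⟨t, ht, rfl⟩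
      exact tgt_star e t ht
  let K : V ⊕ H.edgeSet → Set (ℝ × ℝ) :=
    fun i => φ '' Sum.elim star (fun e => P.arc e '' Set.Icc a b) i
  have K_compact (i) : IsCompact (K i) := by
    rcases i with v | e
    · exact (star_compact v).image hφ
    · exact (isClosed_Icc.isCompact.image (P.arc e).continuous).image hφ
  have K_conn (i) : IsPreconnected (K i) := by
    rcases i with v | e
    · exact (star_conn v).image _ hφ.continuousOn
    · exact (isPreconnected_Icc.image _ (P.arc e).continuous.continuousOn).image _ hφ.continuousOn
  obtain ⟨f, hf, hpos, hsep⟩ := exists_magnification K K_compact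
  have hconn (i) : ConnectedFor GridAdj (cells (f '' K i)) :=
    connectedFor_cells ((K_compact i).image hf) ((K_conn i).image _ hf.continuousOn) (hpos i)
  have hfin (i) : (cells (f '' K i)).Finite := finite_cells ((K_compact i).image hf)
  have hmeet {i j x} (hi : x ∈ K i) (hj : x ∈ K j) :
      (cells (f '' K i) ∩ cells (f '' K j)).Nonempty :=
    have hx := mem_cell_floor (hpos i _ ⟨x, hi, rfl⟩)
    ⟨_, ⟨f x, ⟨x, hi, rfl⟩, hx⟩, ⟨f x, ⟨x, hj, rfl⟩, hx⟩⟩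
  have hdisj {i j} (h : Disjoint (Sum.elim star (fun e => P.arc e '' Set.Icc a b) i)
      (Sum.elim star (fun e => P.arc e '' Set.Icc a b) j)) :
      Disjoint (cells (f '' K i)) (cells (f '' K j)) :=
    hsep i j ((Set.disjoint_image_iff hφi).mpr h)
  obtain ⟨B, hB1, hB2, hB3, hB4, hB5⟩ := exists_branchSets GridAdj.symm src tgt hne
    (fun v => cells (f '' K (Sum.inl v))) (fun e => cells (f '' K (Sum.inr e)))
    (fun v => hconn _) (fun e => hconn _)
    (fun v w h => hdisj (star_disj v w h)) (fun e f h => hdisj (mid_disj e f h))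
    (fun e w hs ht => hdisj (mid_star e w hs ht))
    (fun e => hmeet (x := φ (P.arc e a)) ⟨_, ⟨a, ⟨le_rfl, hab.le⟩, rfl⟩, rfl⟩
      ⟨_, src_star e a le_rfl, rfl⟩)
    (fun e => hmeet (x := φ (P.arc e b)) ⟨_, ⟨b, ⟨hab.le, le_rfl⟩, rfl⟩, rfl⟩
      ⟨_, tgt_star e b le_rfl, rfl⟩)
  -- The grid edge found may point from target to source, so the ends are renamed to follow its
  -- orientation.
  have hρ (e : H.edgeSet) : ∃ u v g, s(u, v) = (e : Sym2 V) ∧ gridTail g ∈ B u ∧ gridHead g ∈ B v := by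
    obtain ⟨x, hx, y, hy, g, ⟨rfl, rfl⟩ | ⟨rfl, rfl⟩⟩ := hB5 e
    · exact ⟨_, _, g, hst e, hx, hy⟩
    · exact ⟨_, _, g, Sym2.eq_swap.trans (hst e), hy, hx⟩
  choose src' tgt' ρ hst' hs' ht' using hρ
  refine ⟨src', tgt', hst', isTwoGenerated_ker_boundary src' tgt' (fun e h => ?_)
    (fun e f hs ht => ?_) B (fun v => ?_) (fun v => ?_) hB3 hB4 ρ hs' ht'⟩
  · have := e.2
    rw [← hst' e, h, SimpleGraph.mem_edgeSet] at this
    exact this.ne rfl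
  · exact Subtype.ext (by rw [← hst' e, ← hst' f, hs, ht])
  · exact ((hfin _).union (Set.finite_iUnion fun e => hfin _)).subset (hB2 v)
  · have hv : φ (P.point v) ∈ K (Sum.inl v) := ⟨_, Or.inl rfl, rfl⟩
    exact (hmeet hv hv).mono fun x hx => hB1 v hx.1

end Drawing

/-! ### The edge bound for planar bipartite graphs. -/

section Bipartite

variable {V : Type*} {H : SimpleGraph V}

/-- A nonzero mod 2 cycle of a bipartite graph has at least four edges. -/
lemma four_le_card_support (hH : H.IsBipartite) (src tgt : H.edgeSet → V)
    (hst : ∀ e, s(src e, tgt e) = (e : Sym2 V)) {z : H.edgeSet →₀ ZMod 2}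
    (hz : boundary src tgt z = 0) (hne : z ≠ 0) : 4 ≤ #z.support := by
  classical
  obtain ⟨c⟩ := hH
  let S : Finset (Sym2 V) := z.support.image Subtype.val
  have hS : #S = #z.support := card_image_of_injective _ Subtype.val_injective
  have hadj {u v} (h : s(u, v) ∈ S) : H.Adj u v := by
    obtain ⟨e, _, he⟩ := mem_image.mp h
    rw [← SimpleGraph.mem_edgeSet, ← he]
    exact e.2
  have hcol {u v} (h : s(u, v) ∈ S) : c u ≠ c v := c.valid (hadj h)
  -- If `s(u, v)` were the only edge of `z` at `u`, the boundary at `u` would be 1.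
  have hnext {u v} (h : s(u, v) ∈ S) : ∃ v', v' ≠ v ∧ s(u, v') ∈ S := by
    by_contra! hcon
    obtain ⟨e, he, hev⟩ := mem_image.mp h
    have hloop : u ≠ v := (hadj h).ne
    have h1 : boundary src tgt z u = 1 := by
      rw [boundary, Finsupp.linearCombination_apply, Finsupp.sum, Finsupp.finsetSum_apply,
        sum_eq_single_of_mem e he]
      · rw [zmod_two_eq_one (Finsupp.mem_support_iff.mp he)]
        have := hst e
        rw [hev] at this
        rcases Sym2.eq_iff.mp this with ⟨h1, h2⟩ | ⟨h1, h2⟩ <;>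
          simp [h1, h2, hloop.symm]
      · intro f hf hfe
        have hfS : s(src f, tgt f) ∈ S := hst f ▸ mem_image_of_mem _ hf
        have hsu : src f ≠ u := by
          intro hu
          rw [hu] at hfS
          by_cases hv : tgt f = v
          · exact hfe (Subtype.ext (by rw [← hst f, hu, hv, hev]))
          · exact hcon _ hv hfS
        have htu : tgt f ≠ u := by
          intro hu
          rw [hu, Sym2.eq_swap] at hfS
          by_cases hv : src f = v
          · exact hfe (Subtype.ext (by rw [← hst f, hu, hv, hev, Sym2.eq_swap]))
          · exact hcon _ hv hfS
        simp [hsu, htu]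
    rw [hz] at h1
    exact absurd h1 (by simp)
  obtain ⟨e, he⟩ := Finsupp.support_nonempty_iff.mpr hne
  obtain ⟨u, v, huv⟩ : ∃ u v, s(u, v) ∈ S :=
    ⟨src e, tgt e, hst e ▸ mem_image_of_mem _ he⟩
  obtain ⟨v', hv', huv'⟩ := hnext huv
  obtain ⟨u', hu', hvu'⟩ := hnext (Sym2.eq_swap ▸ huv : s(v, u) ∈ S)
  obtain ⟨u'', hu'', hvu''⟩ := hnext (Sym2.eq_swap ▸ huv' : s(v', u) ∈ S)
  -- The walk u', v, u, v', u''. Its outer vertices may coincide, but the 2-colouring keeps the four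
  -- edges distinct.
  have hsub : ({s(u, v), s(u, v'), s(v, u'), s(v', u'')} : Finset (Sym2 V)) ⊆ S := by
    simp only [insert_subset_iff, singleton_subset_iff]
    exact ⟨huv, huv', hvu', hvu''⟩
  have c1 := hcol huv
  have c2 := hcol huv'
  have c3 := hcol hvu'
  have c4 := hcol hvu''
  have n3 : v ≠ u'' := by rintro rfl; omega
  have n4 : u ≠ v := by rintro rfl; omega
  have n5 : u ≠ v' := by rintro rfl; omega
  rw [← hS]
  refine le_trans (le_of_eq ?_) (card_le_card hsub)
  rw [card_insert_of_notMem, card_insert_of_notMem, card_insert_of_notMem, card_singleton]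
  · simp only [mem_singleton, Sym2.eq_iff]; grind
  · simp only [mem_insert, mem_singleton, Sym2.eq_iff]; grind
  · simp only [mem_insert, mem_singleton, Sym2.eq_iff]; grind

/-- A finite bipartite planar graph on `n ≥ 1` vertices has at most `2n - 2` edges. -/
theorem ncard_edgeSet_add_two_le [Fintype V] [Nonempty V] (hP : H.IsPlanar)
    (hH : H.IsBipartite) : H.edgeSet.ncard + 2 ≤ 2 * Fintype.card V := by
  classical
  obtain ⟨P⟩ := hP
  obtain ⟨src, tgt, hst, h⟩ := exists_isTwoGenerated_of_planeEmbedding P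
  have h1 := h.mul_finrank_le 4 fun z hz hne => four_le_card_support hH src tgt hst hz hne
  have h2 := card_add_one_le_finrank_ker_boundary src tgt
  rw [← Nat.card_coe_set_eq, Nat.card_eq_fintype_card]
  omega

end Bipartite

end PlanarBipartite

/-! ### Comparing edge counts. -/

theorem mainTheorem1 {D : Type*} {C : Type*} [Fintype D] [Fintype C] (n : ℕ) (hn : 1 ≤ n)
    (hD : Fintype.card D = n) (hC : Fintype.card C = n)
    (G : SimpleGraph (D ⊕ C)) [DecidableRel G.Adj]
    (hG : G.IsBipartiteWith (Set.range Sum.inl) (Set.range Sum.inr))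
    (hdeg : ∀ c : C, 8 ≤ G.degree (Sum.inr c)) :
    ¬ G.IsBiplanar ∧ 3 ≤ G.bipartiteThickness := by
  classical
  have hcard : Fintype.card (D ⊕ C) = 2 * n := by rw [Fintype.card_sum, hD, hC, two_mul]
  have : Nonempty (D ⊕ C) := Fintype.card_pos_iff.mp (by omega)
  -- Every edge has exactly one end in `C`, so the check degrees sum to the number of edges.
  have hE : 8 * n ≤ G.edgeSet.ncard := by
    have hG' : G.IsBipartiteWith (↑(Finset.univ.image (Sum.inl : D → D ⊕ C)))
        (↑(Finset.univ.image (Sum.inr : C → D ⊕ C))) := by simpa using hG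
    rw [← SimpleGraph.coe_edgeFinset, Set.ncard_coe_finset,
      ← SimpleGraph.isBipartiteWith_sum_degrees_eq_card_edges' hG',
      Finset.sum_image Sum.inr_injective.injOn, mul_comm, ← hC, ← smul_eq_mul]
    exact Finset.card_nsmul_le_sum _ _ _ fun c _ => hdeg c
  have hlayer {H : SimpleGraph (D ⊕ C)} (h : H.IsPlanar ∧ H.IsBipartite) :
      H.edgeSet.ncard + 2 ≤ 4 * n := by
    have := PlanarBipartite.ncard_edgeSet_add_two_le h.1 h.2
    omega
  constructor
  · rintro ⟨H₁, H₂, h₁, h₂, -, hU⟩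
    have := Set.ncard_union_le H₁.edgeSet H₂.edgeSet
    rw [hU] at this
    have := hlayer h₁
    have := hlayer h₂
    omega
  · refine le_iInf₂ fun k hk => ?_
    obtain ⟨H, hH, -, hU⟩ := hk
    by_contra hlt
    have hk : k ≤ 2 := by
      have : (k : ℕ∞) < (3 : ℕ) := not_le.mp hlt
      exact Nat.lt_succ_iff.mp (Nat.cast_lt.mp this)
    have h1 : G.edgeSet.ncard ≤ ∑ i, (H i).edgeSet.ncard := by
      have hU' : G.edgeFinset = Finset.univ.biUnion fun i => (H i).edgeFinset := by
        ext e
        rw [SimpleGraph.mem_edgeFinset, ← hU]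
        simp
      simp only [← SimpleGraph.coe_edgeFinset, Set.ncard_coe_finset]
      rw [hU']
      exact Finset.card_biUnion_le
    have h2 : ∑ i, (H i).edgeSet.ncard ≤ k * (4 * n - 2) := by
      refine (Finset.sum_le_card_nsmul _ _ (4 * n - 2) fun i _ => ?_).trans (by simp)
      have := hlayer (hH i)
      omega
    -- At most two layers give at most 8n - 4 edges, fewer than 8n.
    have h3 : k * (4 * n - 2) ≤ 2 * (4 * n - 2) := Nat.mul_le_mul_right _ hk
    omega
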